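/- Let $I\subseteq\mathbb{R}$ be a proper interval, i.e. an interval (open, closed or half-open, bounded or unbounded) with nonempty interior, and let $F\colon I\times I\to I$ satisfy 1. (reflexivity) $F(x,x)=x$ for every $x\in I$; 2. (partial strict monotonicity) for all fixed $x_0,y_0\in I$ the functions $x\mapsto F(x,y_0)$ and $y\mapsto F(x_0,y)$ are strictly increasing on $I$; 3. (bisymmetry) $F(F(x,y),F(u,v))=F(F(x,u),F(y,v))$ for all $x,y,u,v\in I$. Suppose that there are $\alpha,\beta\in I$ with $\alpha\neq\beta$ and $F(\alpha,\beta)=F(\beta,\alpha)$. Then $F$ is symmetric, i.e. $F(x,y)=F(y,x)$ for all $x,y\in I$; $F$ is continuous on $I\times I$; and $F$ is a quasi-arithmetic mean: there exist a proper interval $J\subseteq\mathbb{R}$ and a continuous, strictly increasing bijection $f\colon J\to I$ such that $$F(x,y)=f\left(\frac{f^{-1}(x)+f^{-1}(y)}{2}\right)\qquad\text{for all }x,y\in I.$$ -/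

import Mathlib

/-- A proper interval of the real line: an order-connected set with nonempty interior.
It may be open, closed or half-open, bounded or unbounded. -/
def IsProperInterval (I : Set ℝ) : Prop :=
  I.OrdConnected ∧ (interior I).Nonempty

namespace BinaryMap

/-- `F(x, x) = x` for every `x`. -/
def IsReflexive {X : Type*} (F : X → X → X) : Prop :=
  ∀ x, F x x = x

/-- Both one-variable sections of `F` are strictly increasing. -/
def IsPartiallyStrictlyIncreasing {X : Type*} [Preorder X] (F : X → X → X) : Prop :=
  (∀ y₀, StrictMono fun x => F x y₀) ∧ (∀ x₀, StrictMono fun y => F x₀ y)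

/-- `F(x, y) = F(y, x)` for every `x`, `y`. -/
def IsSymmetric {X : Type*} (F : X → X → X) : Prop :=
  ∀ x y, F x y = F y x

/-- `F(F(x, y), F(u, v)) = F(F(x, u), F(y, v))` for every `x`, `y`, `u`, `v`. -/
def IsBisymmetric {X : Type*} (F : X → X → X) : Prop :=
  ∀ x y u v, F (F x y) (F u v) = F (F x u) (F y v)

/-- `F` is a quasi-arithmetic mean on `I`: there are a proper interval `J` and a continuous,
strictly increasing bijection `f` from `J` onto `I`, with inverse `g`, such that
`F(x, y) = f ((g x + g y) / 2)` on `I`.  The values of `f` off `J` and of `g` off `I` play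
no role, since the interval `J` contains `(g x + g y) / 2`. -/
def IsQuasiArithmeticMean {I : Set ℝ} (F : I → I → I) : Prop :=
  ∃ (J : Set ℝ) (f g : ℝ → ℝ),
    IsProperInterval J ∧ Set.BijOn f J I ∧ Set.InvOn g f J I ∧
      ContinuousOn f J ∧ StrictMonoOn f J ∧
        ∀ x y : I, (F x y : ℝ) = f ((g x + g y) / 2)

end BinaryMap

/-! Bisecting a commuting pair `α < β` with `F` gives points indexed by dyadic fractions, and by
bisymmetry `F` averages the indices (`dyadic_succ_add`). A supremum extends the index to a
coordinate on `[α, β]` carrying `F` to the arithmetic mean. Continuity of `F` is replaced by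
counting: a failure of injectivity would produce uncountably many disjoint open intervals
(`dyadicCoord_strictMonoOn`). So all points of `[α, β]` commute.

Symmetry spreads to `I` by a Baire-type argument: countably many commuting classes cover `I`, while
a noncommuting pair would give nested intervals avoiding each class in turn (`isSymmetric_of_comm`).
The coordinates of all subintervals then agree up to affine maps and glue to a strictly increasing
`G` whose range is an interval; its inverse is the generator. -/

namespace BinaryMap

/-! ### Iterated bisection. -/

section Algebra

variable {X : Type*} {F : X → X → X} {α β : X}

theorem comm_map_map (hb : IsBisymmetric F) {x y u v : X} (hxu : F x u = F u x)
    (hyv : F y v = F v y) : F (F x y) (F u v) = F (F u v) (F x y) := by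
  rw [hb x y u v, hxu, hyv, hb]

/-- The element at position `k / 2 ^ n` between `α` and `β`, obtained by iterated bisection
with `F`. -/
def dyadic (F : X → X → X) (α β : X) : ℕ → ℕ → X
  | 0, k => if k = 0 then α else β
  -- The two halves agree for even `k` and are neighbours for odd `k`.
  | n + 1, k => F (dyadic F α β n (k / 2)) (dyadic F α β n ((k + 1) / 2))

theorem dyadic_zero_right (hr : IsReflexive F) (n : ℕ) : dyadic F α β n 0 = α := by
  induction n with
  | zero => simp [dyadic]
  | succ n ih => simp [dyadic, ih, hr α]

theorem dyadic_succ_two_mul (hr : IsReflexive F) (n k : ℕ) :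
    dyadic F α β (n + 1) (2 * k) = dyadic F α β n k := by
  have h1 : 2 * k / 2 = k := by omega
  have h2 : (2 * k + 1) / 2 = k := by omega
  rw [dyadic, h1, h2, hr]

theorem dyadic_succ_two_mul_add_one (n k : ℕ) :
    dyadic F α β (n + 1) (2 * k + 1) = F (dyadic F α β n k) (dyadic F α β n (k + 1)) := by
  have h1 : (2 * k + 1) / 2 = k := by omega
  have h2 : (2 * k + 1 + 1) / 2 = k + 1 := by omega
  rw [dyadic, h1, h2]

theorem dyadic_add_mul (hr : IsReflexive F) (n m k : ℕ) :
    dyadic F α β (n + m) (k * 2 ^ m) = dyadic F α β n k := by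
  induction m with
  | zero => simp
  | succ m ih =>
    rw [← ih, ← dyadic_succ_two_mul hr (n + m)]
    congr 1
    ring

theorem dyadic_two_pow (hr : IsReflexive F) (n : ℕ) : dyadic F α β n (2 ^ n) = β := by
  have h := dyadic_add_mul (α := α) (β := β) hr 0 n 1
  simpa [dyadic] using h

theorem dyadic_comm (hb : IsBisymmetric F) (hαβ : F α β = F β α) (n i j : ℕ) :
    F (dyadic F α β n i) (dyadic F α β n j) = F (dyadic F α β n j) (dyadic F α β n i) := by
  induction n generalizing i j with
  | zero =>
    simp only [dyadic]
    split_ifs <;> first | rfl | exact hαβ | exact hαβ.symm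
  | succ n ih =>
    simp only [dyadic]
    exact comm_map_map hb (ih _ _) (ih _ _)

/-- Induction on the level, splitting by parity: bisymmetry regroups the four parents into two pairs
with equal index sum. -/
theorem dyadic_succ_add (hr : IsReflexive F) (hb : IsBisymmetric F) (hαβ : F α β = F β α)
    {n i j : ℕ} (hi : i ≤ 2 ^ n) (hj : j ≤ 2 ^ n) :
    dyadic F α β (n + 1) (i + j) = F (dyadic F α β n i) (dyadic F α β n j) := by
  induction n generalizing i j with
  | zero =>
    have hi' : i = 0 ∨ i = 1 := by simp at hi; omega
    have hj' : j = 0 ∨ j = 1 := by simp at hj; omega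
    rcases hi' with rfl | rfl <;> rcases hj' with rfl | rfl <;> simp [dyadic, hαβ]
  | succ n ih =>
    rw [pow_succ] at hi hj
    obtain ⟨a, rfl | rfl⟩ := i.even_or_odd' <;> obtain ⟨b, rfl | rfl⟩ := j.even_or_odd'
    · rw [← mul_add, dyadic_succ_two_mul hr, dyadic_succ_two_mul hr, dyadic_succ_two_mul hr,
        ih (by omega) (by omega)]
    · rw [← add_assoc, ← mul_add, dyadic_succ_two_mul_add_one, dyadic_succ_two_mul hr,
        dyadic_succ_two_mul_add_one, add_assoc, ih (by omega) (by omega),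
        ih (by omega) (by omega), hb, hr]
    · rw [add_right_comm (2 * a), ← mul_add, dyadic_succ_two_mul_add_one, dyadic_succ_two_mul hr,
        dyadic_succ_two_mul_add_one, add_right_comm a b 1, ih (by omega) (by omega),
        ih (by omega) (by omega), hb, hr]
    -- Here the second pair of parents must be swapped first, or the regrouped sums would be `a + b`
    -- and `a + b + 2`. This uses commutation.
    · have h : 2 * a + 1 + (2 * b + 1) = 2 * (a + (b + 1)) := by ring
      rw [h, dyadic_succ_two_mul hr, dyadic_succ_two_mul_add_one, dyadic_succ_two_mul_add_one,
        dyadic_comm hb hαβ n b (b + 1), hb, ← ih (by omega) (by omega),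
        ← ih (by omega) (by omega), show a + 1 + b = a + (b + 1) by ring, hr]

end Algebra

/-! ### The dyadic coordinate. -/

section Order

variable {X : Type*} [LinearOrder X] {F : X → X → X} {α β : X}

theorem IsPartiallyStrictlyIncreasing.map_le (hF : IsPartiallyStrictlyIncreasing F) {a b c d : X}
    (hac : a ≤ c) (hbd : b ≤ d) : F a b ≤ F c d :=
  ((hF.1 b).monotone hac).trans ((hF.2 c).monotone hbd)

theorem IsPartiallyStrictlyIncreasing.map_lt_of_lt_of_le (hF : IsPartiallyStrictlyIncreasing F)
    {a b c d : X} (hac : a < c) (hbd : b ≤ d) : F a b < F c d :=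
  (hF.1 b hac).trans_le ((hF.2 c).monotone hbd)

theorem IsPartiallyStrictlyIncreasing.map_lt_of_le_of_lt (hF : IsPartiallyStrictlyIncreasing F)
    {a b c d : X} (hac : a ≤ c) (hbd : b < d) : F a b < F c d :=
  ((hF.1 b).monotone hac).trans_lt (hF.2 c hbd)

theorem lt_map_of_lt (hr : IsReflexive F) (hF : IsPartiallyStrictlyIncreasing F) {a b : X}
    (h : a < b) : a < F a b := by
  simpa only [hr a] using hF.2 a h

theorem map_lt_of_lt (hr : IsReflexive F) (hF : IsPartiallyStrictlyIncreasing F) {a b : X}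
    (h : a < b) : F a b < b := by
  simpa only [hr b] using hF.1 b h

theorem map_mem_Icc (hr : IsReflexive F) (hF : IsPartiallyStrictlyIncreasing F) {a b x y : X}
    (hx : x ∈ Set.Icc a b) (hy : y ∈ Set.Icc a b) : F x y ∈ Set.Icc a b :=
  ⟨(hr a).ge.trans (hF.map_le hx.1 hy.1), (hF.map_le hx.2 hy.2).trans (hr b).le⟩

/-- By bisymmetry and reflexivity, `F (F w x) (F w y) = F w (F x y)`, and `F w` is injective. -/
theorem comm_map_left_iff (hr : IsReflexive F) (hF : IsPartiallyStrictlyIncreasing F)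
    (hb : IsBisymmetric F) {x y : X} (w : X) :
    F (F w x) (F w y) = F (F w y) (F w x) ↔ F x y = F y x := by
  rw [hb w x w y, hb w y w x, hr w]
  exact (hF.2 w).injective.eq_iff

theorem comm_map_right_iff (hr : IsReflexive F) (hF : IsPartiallyStrictlyIncreasing F)
    (hb : IsBisymmetric F) {x y : X} (w : X) :
    F (F x w) (F y w) = F (F y w) (F x w) ↔ F x y = F y x := by
  rw [hb x w y w, hb y w x w, hr w]
  exact (hF.1 w).injective.eq_iff

theorem dyadic_lt_dyadic (hF : IsPartiallyStrictlyIncreasing F)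
    (hαβ : α < β) {n k l : ℕ} (hkl : k < l) (hl : l ≤ 2 ^ n) :
    dyadic F α β n k < dyadic F α β n l := by
  induction n generalizing k l with
  | zero =>
    have hl' : l = 1 := by simp at hl; omega
    have hk' : k = 0 := by omega
    simpa [dyadic, hl', hk'] using hαβ
  | succ n ih =>
    have hle : ∀ {k l : ℕ}, k ≤ l → l ≤ 2 ^ n → dyadic F α β n k ≤ dyadic F α β n l := by
      intro k l h h'
      rcases h.eq_or_lt with rfl | h
      · rfl
      · exact (ih h h').le
    rw [pow_succ] at hl
    rw [dyadic, dyadic]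
    -- If the lower halves agree, then `k` is even and `l = k + 1`, so the upper halves differ.
    by_cases h : k / 2 < l / 2
    · exact hF.map_lt_of_lt_of_le (ih h (by omega)) (hle (by omega) (by omega))
    · exact hF.map_lt_of_le_of_lt (hle (by omega) (by omega)) (ih (by omega) (by omega))

theorem dyadic_le_dyadic_iff (hr : IsReflexive F) (hF : IsPartiallyStrictlyIncreasing F)
    (hαβ : α < β) {n m k l : ℕ} (hk : k ≤ 2 ^ n) (hl : l ≤ 2 ^ m) :
    dyadic F α β n k ≤ dyadic F α β m l ↔ (k : ℝ) / 2 ^ n ≤ (l : ℝ) / 2 ^ m := by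
  have h : (k : ℝ) / 2 ^ n ≤ (l : ℝ) / 2 ^ m ↔ k * 2 ^ m ≤ l * 2 ^ n := by
    rw [div_le_div_iff₀ (by positivity) (by positivity)]
    exact_mod_cast Iff.rfl
  rw [h, ← dyadic_add_mul hr n m k, ← dyadic_add_mul hr m n l, add_comm m n]
  have hk' : k * 2 ^ m ≤ 2 ^ (n + m) := by rw [pow_add]; gcongr
  have hl' : l * 2 ^ n ≤ 2 ^ (n + m) := by rw [pow_add, mul_comm (2 ^ n)]; gcongr
  constructor
  · intro h
    by_contra! h'
    exact (dyadic_lt_dyadic hF hαβ h' hk').not_ge h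
  · intro h
    rcases h.eq_or_lt with h | h
    · rw [h]
    · exact (dyadic_lt_dyadic hF hαβ h hl').le

/-- The position of `x` relative to the elements `dyadic F α β n k`. -/
noncomputable def dyadicCoord (F : X → X → X) (α β x : X) : ℝ :=
  sSup {r : ℝ | ∃ n k : ℕ, k ≤ 2 ^ n ∧ dyadic F α β n k ≤ x ∧ r = k / 2 ^ n}

theorem div_two_pow_le_dyadicCoord {n k : ℕ} {x : X} (hk : k ≤ 2 ^ n)
    (h : dyadic F α β n k ≤ x) : (k : ℝ) / 2 ^ n ≤ dyadicCoord F α β x := by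
  refine le_csSup ⟨1, ?_⟩ ⟨n, k, hk, h, rfl⟩
  rintro _ ⟨n, k, hk, -, rfl⟩
  exact div_le_one_of_le₀ (by exact_mod_cast hk) (by positivity)

theorem dyadicCoord_le_div_two_pow (hr : IsReflexive F) (hF : IsPartiallyStrictlyIncreasing F)
    (hαβ : α < β) {n k : ℕ} {x : X} (hα : α ≤ x) (hk : k ≤ 2 ^ n)
    (h : x ≤ dyadic F α β n k) : dyadicCoord F α β x ≤ (k : ℝ) / 2 ^ n := by
  refine csSup_le ⟨0, 0, 0, by simp, by simpa [dyadic] using hα, by simp⟩ ?_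
  rintro _ ⟨m, l, hl, hlx, rfl⟩
  exact (dyadic_le_dyadic_iff hr hF hαβ hl hk).1 (hlx.trans h)

theorem dyadicCoord_mem_Icc (hr : IsReflexive F) (hF : IsPartiallyStrictlyIncreasing F)
    (hαβ : α < β) {x : X} (hx : x ∈ Set.Icc α β) : dyadicCoord F α β x ∈ Set.Icc (0 : ℝ) 1 := by
  constructor
  · simpa using div_two_pow_le_dyadicCoord (F := F) (α := α) (β := β) (n := 0) (k := 0) (x := x)
      (by simp) (by simpa [dyadic] using hx.1)
  · simpa using dyadicCoord_le_div_two_pow hr hF hαβ (n := 0) (k := 1) hx.1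
      (by simp) (by simpa [dyadic] using hx.2)

theorem exists_dyadic_bounds (hr : IsReflexive F) (hF : IsPartiallyStrictlyIncreasing F)
    (hαβ : α < β) {x : X} (hx : x ∈ Set.Icc α β) (n : ℕ) :
    (∃ i ≤ 2 ^ n, dyadic F α β n i ≤ x ∧ dyadicCoord F α β x ≤ (i : ℝ) / 2 ^ n + 1 / 2 ^ n) ∧
      ∃ j ≤ 2 ^ n, x ≤ dyadic F α β n j ∧ (j : ℝ) / 2 ^ n ≤ dyadicCoord F α β x + 1 / 2 ^ n := by
  classical
  let i := Nat.findGreatest (fun i => dyadic F α β n i ≤ x) (2 ^ n)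
  have hi : i ≤ 2 ^ n := Nat.findGreatest_le _
  have hix : dyadic F α β n i ≤ x :=
    Nat.findGreatest_spec (P := fun i => dyadic F α β n i ≤ x) (Nat.zero_le _)
      (by simpa [dyadic_zero_right hr] using hx.1)
  have hlow := div_two_pow_le_dyadicCoord hi hix
  have hpos : (0 : ℝ) < 1 / 2 ^ n := by positivity
  rcases hi.eq_or_lt with h | h
  · have hxi : x ≤ dyadic F α β n i := by rw [h, dyadic_two_pow hr]; exact hx.2
    have hup := dyadicCoord_le_div_two_pow hr hF hαβ hx.1 hi hxi
    exact ⟨⟨i, hi, hix, by linarith⟩, i, hi, hxi, by linarith⟩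
  · have hxi : x < dyadic F α β n (i + 1) :=
      not_le.1 (Nat.findGreatest_is_greatest (Nat.lt_succ_self i) h)
    have hup := dyadicCoord_le_div_two_pow hr hF hαβ hx.1 h hxi.le
    push_cast at hup
    rw [add_div] at hup
    refine ⟨⟨i, hi, hix, hup⟩, i + 1, h, hxi.le, ?_⟩
    push_cast
    rw [add_div]
    linarith

/-- Level `n` brackets of `x` and `y` combine by `dyadic_succ_add` into a level `n + 1` bracket of
`F x y`; the error vanishes as `n` grows. -/
theorem dyadicCoord_map (hr : IsReflexive F) (hF : IsPartiallyStrictlyIncreasing F)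
    (hb : IsBisymmetric F) (hαβ : α < β) (hcomm : F α β = F β α) {x y : X}
    (hx : x ∈ Set.Icc α β) (hy : y ∈ Set.Icc α β) :
    dyadicCoord F α β (F x y) = (dyadicCoord F α β x + dyadicCoord F α β y) / 2 := by
  have hclose : ∀ n : ℕ, |dyadicCoord F α β (F x y) -
      (dyadicCoord F α β x + dyadicCoord F α β y) / 2| ≤ (1 / 2) ^ n := by
    intro n
    obtain ⟨⟨i, hi, hix, hi'⟩, j, hj, hxj, hj'⟩ := exists_dyadic_bounds hr hF hαβ hx n
    obtain ⟨⟨k, hk, hky, hk'⟩, l, hl, hyl, hl'⟩ := exists_dyadic_bounds hr hF hαβ hy n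
    have hlow : ((i + k : ℕ) : ℝ) / 2 ^ (n + 1) ≤ dyadicCoord F α β (F x y) := by
      refine div_two_pow_le_dyadicCoord (by rw [pow_succ]; omega) ?_
      rw [dyadic_succ_add hr hb hcomm hi hk]
      exact hF.map_le hix hky
    have hup : dyadicCoord F α β (F x y) ≤ ((j + l : ℕ) : ℝ) / 2 ^ (n + 1) := by
      refine dyadicCoord_le_div_two_pow hr hF hαβ (map_mem_Icc hr hF hx hy).1
        (by rw [pow_succ]; omega) ?_
      rw [dyadic_succ_add hr hb hcomm hj hl]
      exact hF.map_le hxj hyl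
    have h1 : ((i + k : ℕ) : ℝ) / 2 ^ (n + 1) = ((i : ℝ) / 2 ^ n + k / 2 ^ n) / 2 := by
      push_cast; rw [pow_succ]; field_simp
    have h2 : ((j + l : ℕ) : ℝ) / 2 ^ (n + 1) = ((j : ℝ) / 2 ^ n + l / 2 ^ n) / 2 := by
      push_cast; rw [pow_succ]; field_simp
    rw [h1] at hlow
    rw [h2] at hup
    rw [one_div_pow, abs_le]
    constructor <;> linarith
  have hlim : Filter.Tendsto (fun n : ℕ => (1 / 2 : ℝ) ^ n) Filter.atTop (nhds 0) :=
    tendsto_pow_atTop_nhds_zero_of_lt_one (by norm_num) (by norm_num)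
  exact sub_eq_zero.1 (abs_nonpos_iff.1 (ge_of_tendsto' hlim hclose))

theorem dyadicCoord_mono {x y : X} (hα : α ≤ x) (hxy : x ≤ y) :
    dyadicCoord F α β x ≤ dyadicCoord F α β y := by
  refine csSup_le ⟨0, 0, 0, by simp, by simpa [dyadic] using hα, by simp⟩ ?_
  rintro _ ⟨m, l, hl, hlx, rfl⟩
  exact div_two_pow_le_dyadicCoord hl (hlx.trans hxy)

end Order

end BinaryMap

/-! ### Completeness and separability: injectivity of the coordinate. -/

theorem Set.OrdConnected.exists_isLUB_subtype {I : Set ℝ} (hI : I.OrdConnected) {S : Set I}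
    (hne : S.Nonempty) {b : I} (hb : b ∈ upperBounds S) : ∃ x : I, IsLUB S x := by
  obtain ⟨a, ha⟩ := hne
  have hbdd : BddAbove (((↑) : I → ℝ) '' S) :=
    ⟨b, by rintro _ ⟨s, hs, rfl⟩; exact hb hs⟩
  have hlub := isLUB_csSup ⟨_, Set.mem_image_of_mem _ ha⟩ hbdd
  have hmem : sSup (((↑) : I → ℝ) '' S) ∈ I :=
    hI.out a.2 b.2 ⟨hlub.1 ⟨a, ha, rfl⟩, hlub.2 (by rintro _ ⟨s, hs, rfl⟩; exact hb hs)⟩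
  refine ⟨⟨_, hmem⟩, fun s hs => hlub.1 ⟨s, hs, rfl⟩, fun u hu => hlub.2 ?_⟩
  rintro _ ⟨s, hs, rfl⟩
  exact hu hs

/-- Nonempty open intervals indexed by `ι` can be labelled by rationals lying in them. -/
theorem Set.OrdConnected.exists_rat_mem_Ioo {ι : Type*} {I : Set ℝ} (hI : I.OrdConnected)
    {a b : ι → I} (hab : ∀ i, a i < b i) :
    ∃ q : ι → ℚ, ∀ i, ∃ c : I, (c : ℝ) = q i ∧ c ∈ Set.Ioo (a i) (b i) := by
  choose q hq using fun i => exists_rat_btwn (Subtype.coe_lt_coe.2 (hab i))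
  exact ⟨q, fun i => ⟨⟨q i, hI.out (a i).2 (b i).2 ⟨(hq i).1.le, (hq i).2.le⟩⟩, rfl, hq i⟩⟩

namespace BinaryMap

variable {I : Set ℝ} {F : I → I → I} {α β : I}

/-- The preimage of `t` is the supremum of the dyadic points with index at most `t`. -/
theorem dyadicCoord_surjOn (hI : I.OrdConnected) (hr : IsReflexive F)
    (hF : IsPartiallyStrictlyIncreasing F) (hαβ : α < β) :
    Set.SurjOn (dyadicCoord F α β) (Set.Icc α β) (Set.Icc 0 1) := by
  intro t ht
  let S : Set I := {z | ∃ n k : ℕ, k ≤ 2 ^ n ∧ (k : ℝ) / 2 ^ n ≤ t ∧ z = dyadic F α β n k}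
  have hα : α ∈ S := ⟨0, 0, by simp, by simpa using ht.1, by simp [dyadic]⟩
  have hβ : β ∈ upperBounds S := by
    rintro _ ⟨n, k, hk, -, rfl⟩
    refine ((dyadic_le_dyadic_iff hr hF hαβ hk le_rfl).2 ?_).trans (dyadic_two_pow hr n).le
    gcongr
  obtain ⟨y, hy⟩ := hI.exists_isLUB_subtype ⟨α, hα⟩ hβ
  have hyI : y ∈ Set.Icc α β := ⟨hy.1 hα, hy.2 hβ⟩
  have hclose : ∀ n : ℕ, |dyadicCoord F α β y - t| ≤ (1 / 2) ^ n := by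
    intro n
    have hp : (0 : ℝ) < 2 ^ n := by positivity
    have hfl : ((⌊t * 2 ^ n⌋₊ : ℕ) : ℝ) ≤ t * 2 ^ n :=
      Nat.floor_le (mul_nonneg ht.1 hp.le)
    have hfu : t * 2 ^ n < (⌊t * 2 ^ n⌋₊ : ℕ) + 1 := Nat.lt_floor_add_one _
    set k := ⌊t * 2 ^ n⌋₊
    have hk : k ≤ 2 ^ n := by
      have h : (k : ℝ) ≤ 2 ^ n := hfl.trans (mul_le_of_le_one_left hp.le ht.2)
      exact_mod_cast h
    have hkt : (k : ℝ) / 2 ^ n ≤ t := (div_le_iff₀ hp).2 hfl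
    have htk : t < k / 2 ^ n + 1 / 2 ^ n := by rwa [← add_div, lt_div_iff₀ hp]
    have hlow : (k : ℝ) / 2 ^ n ≤ dyadicCoord F α β y :=
      div_two_pow_le_dyadicCoord hk (hy.1 ⟨n, k, hk, hkt, rfl⟩)
    have hup : dyadicCoord F α β y ≤ k / 2 ^ n + 1 / 2 ^ n := by
      rcases hk.eq_or_lt with h | h
      · have h1 := (dyadicCoord_mem_Icc hr hF hαβ hyI).2
        have h2 : (k : ℝ) / 2 ^ n = 1 := by rw [h]; push_cast; exact div_self hp.ne'
        rw [h2]
        exact h1.trans (le_add_of_nonneg_right (by positivity))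
      · have h1 : y ≤ dyadic F α β n (k + 1) := by
          refine hy.2 ?_
          rintro _ ⟨m, l, hl, hlt, rfl⟩
          rw [dyadic_le_dyadic_iff hr hF hαβ hl h]
          push_cast
          rw [add_div]
          exact hlt.trans htk.le
        have h2 := dyadicCoord_le_div_two_pow hr hF hαβ hyI.1 h h1
        push_cast at h2
        rwa [add_div] at h2
    rw [one_div_pow, abs_le]
    constructor <;> linarith
  have hlim : Filter.Tendsto (fun n : ℕ => (1 / 2 : ℝ) ^ n) Filter.atTop (nhds 0) :=
    tendsto_pow_atTop_nhds_zero_of_lt_one (by norm_num) (by norm_num)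
  exact ⟨y, hyI, sub_eq_zero.1 (abs_nonpos_iff.1 (ge_of_tendsto' hlim hclose))⟩

/-- If `x < y` shared a coordinate, then for `z t` of coordinate `t` the coordinate would be
constant on `(F x (z t), F y (z t))`, with a value depending injectively on `t`. These intervals
would be disjoint, so the rationals in them would make `[0, 1]` countable. -/
theorem dyadicCoord_strictMonoOn (hI : I.OrdConnected) (hr : IsReflexive F)
    (hF : IsPartiallyStrictlyIncreasing F) (hb : IsBisymmetric F) (hαβ : α < β)
    (hcomm : F α β = F β α) : StrictMonoOn (dyadicCoord F α β) (Set.Icc α β) := by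
  intro x hx y hy hxy
  refine (dyadicCoord_mono hx.1 hxy.le).lt_of_ne fun hg => ?_
  choose z hz hgz using fun t : Set.Icc (0 : ℝ) 1 => dyadicCoord_surjOn hI hr hF hαβ t.2
  obtain ⟨q, hq⟩ := hI.exists_rat_mem_Ioo (a := fun t => F x (z t)) (b := fun t => F y (z t))
    fun t => hF.1 _ hxy
  have hinj : Function.Injective q := by
    have key : ∀ t (c : I), c ∈ Set.Ioo (F x (z t)) (F y (z t)) →
        dyadicCoord F α β c = (dyadicCoord F α β x + t) / 2 := by
      intro t c hc
      have hα := (map_mem_Icc hr hF hx (hz t)).1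
      refine le_antisymm ?_ ?_
      · refine (dyadicCoord_mono (hα.trans hc.1.le) hc.2.le).trans_eq ?_
        rw [dyadicCoord_map hr hF hb hαβ hcomm hy (hz t), hg, hgz]
      · refine (dyadicCoord_mono hα hc.1.le).trans_eq' ?_
        rw [dyadicCoord_map hr hF hb hαβ hcomm hx (hz t), hgz]
    intro s t hst
    obtain ⟨c, hc, hcs⟩ := hq s
    obtain ⟨d, hd, hdt⟩ := hq t
    have hcd : c = d := Subtype.ext (by rw [hc, hd, hst])
    have h1 := key s c hcs
    rw [hcd, key t d hdt] at h1
    exact Subtype.ext (by linarith)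
  have hcount : (Set.Icc (0 : ℝ) 1).Countable := hinj.countable
  exact (Cardinal.mk_Icc_real (zero_lt_one' ℝ)).not_lt
    ((Cardinal.le_aleph0_iff_set_countable.2 hcount).trans_lt Cardinal.aleph0_lt_continuum)

/-- If two points commute under `F`, so do any two points between them. -/
theorem comm_of_mem_Icc (hI : I.OrdConnected) (hr : IsReflexive F)
    (hF : IsPartiallyStrictlyIncreasing F) (hb : IsBisymmetric F) (hαβ : α < β)
    (hcomm : F α β = F β α) {x y : I} (hx : x ∈ Set.Icc α β) (hy : y ∈ Set.Icc α β) :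
    F x y = F y x := by
  refine (dyadicCoord_strictMonoOn hI hr hF hb hαβ hcomm).injOn (map_mem_Icc hr hF hx hy)
    (map_mem_Icc hr hF hy hx) ?_
  rw [dyadicCoord_map hr hF hb hαβ hcomm hx hy, dyadicCoord_map hr hF hb hαβ hcomm hy hx, add_comm]

/-! ### From one commuting pair to symmetry. -/

/-- If some pair of distinct points commutes, then `I` is covered by countably many sets of
pairwise commuting points. -/
theorem exists_rat_labelling (hI : I.OrdConnected) (hr : IsReflexive F)
    (hF : IsPartiallyStrictlyIncreasing F) (hb : IsBisymmetric F) (hαβ : α < β)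
    (hcomm : F α β = F β α) : ∃ q : I → ℚ, ∀ z w, q z = q w → F z w = F w z := by
  obtain ⟨q, hq⟩ := hI.exists_rat_mem_Ioo (a := fun z => F z α) (b := fun z => F z β)
    fun z => hF.2 z hαβ
  have key : ∀ z w, z ≤ w → q z = q w → F z w = F w z := by
    intro z w hzw h
    obtain ⟨c, hc, hcz⟩ := hq z
    obtain ⟨d, hd, hdw⟩ := hq w
    have hcd : c = d := Subtype.ext (by rw [hc, hd, h])
    have hends := (comm_map_left_iff hr hF hb z).2 hcomm
    have hlt : F z α < F z β := hF.2 z hαβ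
    rw [← comm_map_right_iff hr hF hb α]
    -- The shared rational makes the intervals of `z` and `w` overlap, so `F w α` lies between the
    -- commuting points `F z α` and `F z β`.
    refine comm_of_mem_Icc hI hr hF hb hlt hends ⟨le_rfl, hlt.le⟩ ⟨hF.map_le hzw le_rfl, ?_⟩
    exact hdw.1.le.trans (hcd ▸ hcz.2.le)
  refine ⟨q, fun z w h => ?_⟩
  rcases le_total z w with hzw | hwz
  · exact key z w hzw h
  · exact (key w z hwz h.symm).symm

/-- A noncommuting pair contains another one avoiding a given set of pairwise commuting points. -/
theorem exists_not_comm_avoiding (hI : I.OrdConnected) (hr : IsReflexive F)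
    (hF : IsPartiallyStrictlyIncreasing F) (hb : IsBisymmetric F) {a b : I} (hab : a < b)
    (hne : F a b ≠ F b a) {K : Set I} (hK : ∀ x ∈ K, ∀ y ∈ K, F x y = F y x) :
    ∃ c d, c < d ∧ F c d ≠ F d c ∧ a ≤ c ∧ d ≤ b ∧ ∀ x ∈ Set.Icc c d, x ∉ K := by
  have hac : a < F a b := lt_map_of_lt hr hF hab
  have hcb : F a b < b := map_lt_of_lt hr hF hab
  have hac' : F a (F a b) ≠ F (F a b) a := by
    have := (comm_map_left_iff hr hF hb a (x := a) (y := b)).not.2 hne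
    rwa [hr a] at this
  have hcb' : F (F a b) b ≠ F b (F a b) := by
    have := (comm_map_right_iff hr hF hb b (x := a) (y := b)).not.2 hne
    rwa [hr b] at this
  set c := F a b
  have had : a < F a c := lt_map_of_lt hr hF hac
  have hdc : F a c < c := map_lt_of_lt hr hF hac
  have had' : F a (F a c) ≠ F (F a c) a := by
    have := (comm_map_left_iff hr hF hb a (x := a) (y := c)).not.2 hac'
    rwa [hr a] at this
  have hdc' : F (F a c) c ≠ F c (F a c) := by
    have := (comm_map_right_iff hr hF hb c (x := a) (y := c)).not.2 hac'
    rwa [hr c] at this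
  set d := F a c
  -- Now `a < d < c < b`. If `K` met both `[a, d]` and `[c, b]`, the two points would commute, hence
  -- so would `d` and `c` between them.
  by_cases h : ∃ x ∈ Set.Icc a d, x ∈ K
  · obtain ⟨x, hx, hxK⟩ := h
    refine ⟨c, b, hcb, hcb', hac.le, le_rfl, fun y hy hyK => hdc' ?_⟩
    have hxy : x < y := hx.2.trans_lt (hdc.trans_le hy.1)
    exact comm_of_mem_Icc hI hr hF hb hxy (hK x hxK y hyK) ⟨hx.2, hdc.le.trans hy.1⟩
      ⟨hx.2.trans hdc.le, hy.1⟩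
  · push Not at h
    exact ⟨a, d, had, had', le_rfl, hdc.le.trans hcb.le, h⟩

theorem isSymmetric_of_comm (hI : I.OrdConnected) (hr : IsReflexive F)
    (hF : IsPartiallyStrictlyIncreasing F) (hb : IsBisymmetric F) (hαβ : α < β)
    (hcomm : F α β = F β α) : IsSymmetric F := by
  obtain ⟨q, hq⟩ := exists_rat_labelling hI hr hF hb hαβ hcomm
  suffices key : ∀ a b, a < b → F a b = F b a by
    intro x y
    rcases lt_trichotomy x y with h | rfl | h
    · exact key x y h
    · rfl
    · exact (key y x h).symm
  by_contra! ⟨a₀, b₀, hab₀, hne₀⟩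
  let P := {p : I × I // p.1 < p.2 ∧ F p.1 p.2 ≠ F p.2 p.1}
  have step : ∀ (n : ℕ) (p : P), ∃ p' : P, p.1.1 ≤ p'.1.1 ∧ p'.1.2 ≤ p.1.2 ∧
      ∀ x ∈ Set.Icc p'.1.1 p'.1.2, Encodable.encode (q x) ≠ n := by
    intro n p
    obtain ⟨c, d, hcd, hne, hc, hd, h⟩ := exists_not_comm_avoiding hI hr hF hb p.2.1 p.2.2
      (K := {x | Encodable.encode (q x) = n}) fun x hx y hy =>
        hq x y (Encodable.encode_injective (hx.trans hy.symm))
    exact ⟨⟨(c, d), hcd, hne⟩, hc, hd, h⟩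
  choose next hleft hright havoid using step
  let s : ℕ → P := fun n => Nat.rec ⟨(a₀, b₀), hab₀, hne₀⟩ next n
  have hmono : Monotone fun n => (s n).1.1 := monotone_nat_of_le_succ fun n => hleft n (s n)
  have hanti : Antitone fun n => (s n).1.2 := antitone_nat_of_succ_le fun n => hright n (s n)
  have hle : ∀ m n, (s m).1.1 ≤ (s n).1.2 := fun m n =>
    ((hmono (le_max_left m n)).trans (s (max m n)).2.1.le).trans (hanti (le_max_right m n))
  obtain ⟨x, hx⟩ := hI.exists_isLUB_subtype (Set.range_nonempty fun n => (s n).1.1)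
    (b := (s 0).1.2) (by rintro _ ⟨m, rfl⟩; exact hle m 0)
  -- The common point `x` has some label `n`, yet interval `n + 1` was chosen to avoid that label.
  refine havoid (Encodable.encode (q x)) (s (Encodable.encode (q x))) x ⟨?_, ?_⟩ rfl
  · exact hx.1 ⟨Encodable.encode (q x) + 1, rfl⟩
  · refine hx.2 ?_
    rintro _ ⟨m, rfl⟩
    exact hle m (Encodable.encode (q x) + 1)

/-! ### Gluing the coordinates. -/

/-- A monotone map turning `F` into the arithmetic mean is, on each interval, an affine function
of the dyadic coordinate. -/
theorem eq_affine_dyadicCoord (hr : IsReflexive F) (hF : IsPartiallyStrictlyIncreasing F)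
    (hαβ : α < β) {h : I → ℝ} (hmono : MonotoneOn h (Set.Icc α β))
    (hmap : ∀ x ∈ Set.Icc α β, ∀ y ∈ Set.Icc α β, h (F x y) = (h x + h y) / 2)
    {x : I} (hx : x ∈ Set.Icc α β) :
    h x = h α + (h β - h α) * dyadicCoord F α β x := by
  have hmem : ∀ n k, dyadic F α β n k ∈ Set.Icc α β := by
    intro n
    induction n with
    | zero =>
      intro k
      simp only [dyadic]
      split_ifs
      · exact ⟨le_rfl, hαβ.le⟩
      · exact ⟨hαβ.le, le_rfl⟩
    | succ n ih => exact fun k => map_mem_Icc hr hF (ih _) (ih _)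
  have hdyadic : ∀ n k : ℕ, k ≤ 2 ^ n →
      h (dyadic F α β n k) = h α + (h β - h α) * (k / 2 ^ n) := by
    intro n
    induction n with
    | zero =>
      intro k hk
      have hk' : k = 0 ∨ k = 1 := by simp at hk; omega
      rcases hk' with rfl | rfl <;> simp [dyadic]
    | succ n ih =>
      intro k hk
      rw [pow_succ] at hk
      rw [dyadic, hmap _ (hmem _ _) _ (hmem _ _), ih _ (by omega), ih _ (by omega)]
      have hsum : (((k / 2 : ℕ) : ℝ) + ((k + 1) / 2 : ℕ)) = k := by
        exact_mod_cast (by omega : k / 2 + (k + 1) / 2 = k)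
      rw [pow_succ, ← hsum]
      field_simp
      ring
  have hΔ : 0 ≤ h β - h α :=
    sub_nonneg.2 (hmono ⟨le_rfl, hαβ.le⟩ ⟨hαβ.le, le_rfl⟩ hαβ.le)
  have hclose : ∀ n : ℕ, |h x - (h α + (h β - h α) * dyadicCoord F α β x)| ≤
      (h β - h α) * (1 / 2) ^ n := by
    intro n
    obtain ⟨⟨i, hi, hix, hi'⟩, j, hj, hxj, hj'⟩ := exists_dyadic_bounds hr hF hαβ hx n
    have h1 := hmono (hmem n i) hx hix
    have h2 := hmono hx (hmem n j) hxj
    rw [hdyadic n i hi] at h1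
    rw [hdyadic n j hj] at h2
    have h3 := mul_le_mul_of_nonneg_left hi' hΔ
    have h4 := mul_le_mul_of_nonneg_left hj' hΔ
    rw [mul_add] at h3 h4
    rw [one_div_pow, abs_le]
    constructor <;> linarith
  have hlim : Filter.Tendsto (fun n : ℕ => (h β - h α) * (1 / 2 : ℝ) ^ n) Filter.atTop
      (nhds ((h β - h α) * 0)) :=
    (tendsto_pow_atTop_nhds_zero_of_lt_one (by norm_num) (by norm_num)).const_mul _
  rw [mul_zero] at hlim
  exact sub_eq_zero.1 (abs_nonpos_iff.1 (ge_of_tendsto' hlim hclose))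

theorem exists_strictMono_map_eq_midpoint (hI : I.OrdConnected) (hr : IsReflexive F)
    (hF : IsPartiallyStrictlyIncreasing F) (hb : IsBisymmetric F) (hs : IsSymmetric F)
    (hαβ : α < β) :
    ∃ G : I → ℝ, StrictMono G ∧ ∀ x y, G (F x y) = (G x + G y) / 2 := by
  -- Normalising to `0` at `α` and `1` at `β` removes the affine ambiguity, so the value does not
  -- depend on the interval `[a, b]`.
  let c : I → I → I → ℝ := fun a b x =>
    (dyadicCoord F a b x - dyadicCoord F a b α) / (dyadicCoord F a b β - dyadicCoord F a b α)
  have hpos : ∀ {a b}, a ≤ α → β ≤ b → 0 < dyadicCoord F a b β - dyadicCoord F a b α := by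
    intro a b ha hb'
    exact sub_pos.2 (dyadicCoord_strictMonoOn hI hr hF hb ((ha.trans_lt hαβ).trans_le hb') (hs _ _)
      ⟨ha, hαβ.le.trans hb'⟩ ⟨ha.trans hαβ.le, hb'⟩ hαβ)
  have hcongr : ∀ {a b a' b' x}, a ≤ a' → a' ≤ α → β ≤ b' → b' ≤ b → x ∈ Set.Icc a' b' →
      c a b x = c a' b' x := by
    intro a b a' b' x haa ha hb' hbb hx
    have hlt' : a' < b' := (ha.trans_lt hαβ).trans_le hb'
    have hlt : a < b := (haa.trans_lt hlt').trans_le hbb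
    have hsub : Set.Icc a' b' ⊆ Set.Icc a b := Set.Icc_subset_Icc haa hbb
    have hsm := dyadicCoord_strictMonoOn hI hr hF hb hlt (hs a b)
    have haff : ∀ y ∈ Set.Icc a' b', _ := fun y hy => eq_affine_dyadicCoord hr hF hlt'
      (h := dyadicCoord F a b) (hsm.monotoneOn.mono hsub)
      (fun x hx y hy => dyadicCoord_map hr hF hb hlt (hs a b) (hsub hx) (hsub hy)) hy
    have hΔ : 0 < dyadicCoord F a b b' - dyadicCoord F a b a' :=
      sub_pos.2 (hsm (hsub ⟨le_rfl, hlt'.le⟩) (hsub ⟨hlt'.le, le_rfl⟩) hlt')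
    simp only [c]
    rw [haff x hx, haff α ⟨ha, hαβ.le.trans hb'⟩, haff β ⟨ha.trans hαβ.le, hb'⟩,
      add_sub_add_left_eq_sub, add_sub_add_left_eq_sub, ← mul_sub, ← mul_sub,
      mul_div_mul_left _ _ hΔ.ne']
  let G : I → ℝ := fun x => c (min α x) (max β x) x
  have hG : ∀ {a b x}, a ≤ α → β ≤ b → x ∈ Set.Icc a b → G x = c a b x := by
    intro a b x ha hb' hx
    exact (hcongr (le_min ha hx.1) (min_le_left _ _) (le_max_left _ _) (max_le hb' hx.2)
      ⟨min_le_right _ _, le_max_right _ _⟩).symm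
  refine ⟨G, fun x y hxy => ?_, fun x y => ?_⟩
  · have ha : min α x ≤ α := min_le_left _ _
    have hb' : β ≤ max β y := le_max_left _ _
    have hx : x ∈ Set.Icc (min α x) (max β y) :=
      ⟨min_le_right _ _, hxy.le.trans (le_max_right _ _)⟩
    have hy : y ∈ Set.Icc (min α x) (max β y) :=
      ⟨(min_le_right _ _).trans hxy.le, le_max_right _ _⟩
    rw [hG ha hb' hx, hG ha hb' hy]
    refine div_lt_div_of_pos_right (sub_lt_sub_right ?_ _) (hpos ha hb')
    exact dyadicCoord_strictMonoOn hI hr hF hb ((ha.trans_lt hαβ).trans_le hb') (hs _ _) hx hy hxy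
  · have ha : min α (min x y) ≤ α := min_le_left _ _
    have hb' : β ≤ max β (max x y) := le_max_left _ _
    have hx : x ∈ Set.Icc (min α (min x y)) (max β (max x y)) := by simp
    have hy : y ∈ Set.Icc (min α (min x y)) (max β (max x y)) := by simp
    rw [hG ha hb' hx, hG ha hb' hy, hG ha hb' (map_mem_Icc hr hF hx hy)]
    simp only [c]
    rw [dyadicCoord_map hr hF hb ((ha.trans_lt hαβ).trans_le hb') (hs _ _) hx hy]
    ring

/-- On `[x, y]` the map `G` is affine in a coordinate that takes every value in `[0, 1]`, so no
intermediate value is skipped. -/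
theorem ordConnected_range (hI : I.OrdConnected) (hr : IsReflexive F)
    (hF : IsPartiallyStrictlyIncreasing F) {G : I → ℝ} (hG : StrictMono G)
    (hmap : ∀ x y, G (F x y) = (G x + G y) / 2) : (Set.range G).OrdConnected := by
  refine ⟨?_⟩
  rintro _ ⟨x, rfl⟩ _ ⟨y, rfl⟩ r ⟨hxr, hry⟩
  rcases (hG.le_iff_le.1 (hxr.trans hry)).eq_or_lt with rfl | hxy
  · exact ⟨x, le_antisymm hxr hry⟩
  · have hΔ : 0 < G y - G x := sub_pos.2 (hG hxy)
    obtain ⟨z, hz, hzr⟩ := dyadicCoord_surjOn hI hr hF hxy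
      (show (r - G x) / (G y - G x) ∈ Set.Icc (0 : ℝ) 1 from
        ⟨div_nonneg (by linarith) hΔ.le, (div_le_one hΔ).2 (by linarith)⟩)
    refine ⟨z, ?_⟩
    rw [eq_affine_dyadicCoord hr hF hxy (hG.monotone.monotoneOn _)
      (fun x _ y _ => hmap x y) hz, hzr, mul_div_cancel₀ _ hΔ.ne']
    ring

end BinaryMap

theorem theorem3p1 (I : Set ℝ) (hI : IsProperInterval I) (F : I → I → I)
    (hrefl : BinaryMap.IsReflexive F)
    (hmono : BinaryMap.IsPartiallyStrictlyIncreasing F)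
    (hbisymm : BinaryMap.IsBisymmetric F)
    (hpair : ∃ α β : I, α ≠ β ∧ F α β = F β α) :
    BinaryMap.IsSymmetric F ∧
      Continuous (fun p : I × I => F p.1 p.2) ∧
      BinaryMap.IsQuasiArithmeticMean F := by
  have hIc : I.OrdConnected := hI.1
  obtain ⟨α, β, hαβ, hcomm⟩ : ∃ α β : I, α < β ∧ F α β = F β α := by
    obtain ⟨α, β, hne, hcomm⟩ := hpair
    rcases hne.lt_or_gt with h | h
    · exact ⟨α, β, h, hcomm⟩
    · exact ⟨β, α, h, hcomm.symm⟩
  have hs := BinaryMap.isSymmetric_of_comm hIc hrefl hmono hbisymm hαβ hcomm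
  obtain ⟨G, hG, hmap⟩ :=
    BinaryMap.exists_strictMono_map_eq_midpoint hIc hrefl hmono hbisymm hs hαβ
  have hJ : (Set.range G).OrdConnected := BinaryMap.ordConnected_range hIc hrefl hmono hG hmap
  -- Both sets are order-connected, so their subspace topologies are order topologies and `e` is a
  -- homeomorphism.
  let e : I ≃o Set.range G := hG.orderIso G
  have hmid : ∀ x y, (G x + G y) / 2 ∈ Set.range G := fun x y => ⟨F x y, hmap x y⟩
  have hFe : ∀ x y, F x y = e.symm ⟨(G x + G y) / 2, hmid x y⟩ := fun x y =>
    (e.symm_apply_eq.2 (Subtype.ext (hmap x y).symm)).symm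
  have hGcont : Continuous G := continuous_subtype_val.comp e.continuous
  refine ⟨hs, ?_, ?_⟩
  · simp only [hFe]
    exact e.symm.continuous.comp
      (((hGcont.comp continuous_fst).add (hGcont.comp continuous_snd)).div_const 2 |>.subtype_mk _)
  · classical
    let f : ℝ → ℝ := fun r => if h : r ∈ Set.range G then (e.symm ⟨r, h⟩ : ℝ) else 0
    let g : ℝ → ℝ := fun x => if h : x ∈ I then G ⟨x, h⟩ else 0
    have hf : ∀ {r} (h : r ∈ Set.range G), f r = e.symm ⟨r, h⟩ := fun h => dif_pos h
    have hg : ∀ x : I, g x = G x := fun x => dif_pos x.2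
    have hfG : ∀ x, f (G x) = x := fun x => by
      rw [hf ⟨x, rfl⟩]
      exact congrArg Subtype.val (e.symm_apply_apply x)
    have hinv : Set.InvOn g f (Set.range G) I := by
      constructor
      · rintro _ ⟨x, rfl⟩
        rw [hfG, hg]
      · intro x hx
        rw [hg ⟨x, hx⟩, hfG]
    have hstrict : StrictMonoOn f (Set.range G) := by
      rintro _ ⟨x, rfl⟩ _ ⟨y, rfl⟩ hxy
      rw [hfG, hfG]
      exact hG.lt_iff_lt.1 hxy
    refine ⟨Set.range G, f, g, ⟨hJ, ?_⟩, hinv.bijOn ?_ ?_, hinv, ?_, hstrict, fun x y => ?_⟩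
    · refine Set.Nonempty.mono (interior_maximal ?_ isOpen_Ioo) (Set.nonempty_Ioo.2 (hG hαβ))
      exact Set.Ioo_subset_Icc_self.trans (hJ.out ⟨α, rfl⟩ ⟨β, rfl⟩)
    · rintro _ ⟨x, rfl⟩
      rw [hfG]
      exact x.2
    · intro x hx
      rw [hg ⟨x, hx⟩]
      exact ⟨_, rfl⟩
    · rw [continuousOn_iff_continuous_domRestrict]
      have hrestrict : (Set.range G).domRestrict f = fun r => (e.symm r : ℝ) :=
        funext fun r => hf r.2
      rw [hrestrict]
      exact continuous_subtype_val.comp e.symm.continuous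
    · rw [hg, hg, hf (hmid x y), hFe]
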